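/- Let $k\ge 0$ be an integer, $p=2k+1$, $0<l<\infty$, let $V,\widetilde V$ be unitary operators ($k\times k$ matrices) on $\mathbb{C}^k$ and let $\theta\in\mathbb{C}$ with $|\theta|=1$. Let $W_2^p(0,l)$ be the set of $y\in L^2(0,l)$ (complex-valued) that are $p-1$ times continuously differentiable on $[0,l]$, with $y^{(p-1)}$ absolutely continuous and $y^{(p)}\in L^2(0,l)$. Let $J_k$ be the $k\times k$ matrix with entries $(J_k)_{i,\,k+1-i}=(-1)^{i-1}$ for $1\le i\le k$ and all other entries $0$. For $y\in W_2^p(0,l)$ and $x\in[0,l]$ put $$Y_0(x)=\operatorname{col}\bigl(y(x),y'(x),\dots,y^{(k-1)}(x)\bigr),\qquad Y_1(x)=\operatorname{col}\bigl(y^{(k+1)}(x),y^{(k+2)}(x),\dots,y^{(2k)}(x)\bigr).$$ Then the operator $y\mapsto(-iD)^p y=(-i)^p y^{(p)}$ in the Hilbert space $L^2(0,l)$, whose domain is the set of all $y\in W_2^p(0,l)$ that satisfy the boundary conditions $$y^{(k)}(l)=\theta\,y^{(k)}(0),$$ $$2Y_0(l)=(V+\widetilde V)Y_0(0)+(V-\widetilde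 V)J_kY_1(0),$$ $$2J_kY_1(l)=(V-\widetilde V)Y_0(0)+(V+\widetilde V)J_kY_1(0),$$ is densely defined and self-adjoint. (For $k=0$ only the first condition remains.) -/

import Mathlib

open MeasureTheory Set
open scoped Matrix

namespace OddBVP

/-- Lebesgue measure on `(0, l)`. -/
noncomputable abbrev vol (l : ℝ) : Measure ℝ := volume.restrict (Ioo 0 l)

/-- The complex Hilbert space `L²(0, l)`. -/
noncomputable abbrev L2 (l : ℝ) : Type := Lp ℂ 2 (vol l)

/-- The `j`-th derivative of `y` on the closed interval `[0, l]` (one-sided at the end points). -/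
noncomputable def der (l : ℝ) (j : ℕ) (y : ℝ → ℂ) : ℝ → ℂ := iteratedDerivWithin j y (Icc 0 l)

/-- `y` represents an element of the Sobolev space `W₂ⁿ⁺¹(0, l)`: `y` is `n` times continuously
differentiable on `[0, l]`, `y⁽ⁿ⁾` is absolutely continuous there, and its derivative `y⁽ⁿ⁺¹⁾`,
which exists almost everywhere, lies in `L²(0, l)`. -/
structure IsSobolevSucc (l : ℝ) (n : ℕ) (y : ℝ → ℂ) : Prop where
  contDiffOn : ContDiffOn ℝ (n : WithTop ℕ∞) y (Icc 0 l)
  absolutelyContinuous : AbsolutelyContinuousOnInterval (der l n y) 0 l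
  memLp : MemLp (der l (n + 1) y) 2 (vol l)

/-- The `m × m` matrix with `1, -1, …, (-1) ^ (m - 1)` on the antidiagonal, from the upper right
corner to the lower left corner, and `0` elsewhere. -/
def J (m : ℕ) : Matrix (Fin m) (Fin m) ℂ :=
  Matrix.of fun i j => if (i : ℕ) + (j : ℕ) + 1 = m then (-1) ^ (i : ℕ) else 0

/-- `Y₀(x) = col (y(x), y'(x), …, y⁽ᵏ⁻¹⁾(x))`. -/
noncomputable def Y₀ (l : ℝ) (k : ℕ) (y : ℝ → ℂ) (x : ℝ) : Fin k → ℂ :=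
  fun j => der l (j : ℕ) y x

/-- `Y₁(x) = col (y⁽ᵏ⁺¹⁾(x), y⁽ᵏ⁺²⁾(x), …, y⁽²ᵏ⁾(x))`. -/
noncomputable def Y₁ (l : ℝ) (k : ℕ) (y : ℝ → ℂ) (x : ℝ) : Fin k → ℂ :=
  fun j => der l (k + 1 + (j : ℕ)) y x

/-- The unseparated boundary conditions for the odd order `2 * k + 1`. -/
structure BoundaryCond (l : ℝ) (k : ℕ) (θ : ℂ) (V W : Matrix (Fin k) (Fin k) ℂ)
    (y : ℝ → ℂ) : Prop where
  mid : der l k y l = θ * der l k y 0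
  fst : (2 : ℂ) • Y₀ l k y l = (V + W) *ᵥ Y₀ l k y 0 + (V - W) *ᵥ (J k *ᵥ Y₁ l k y 0)
  snd : (2 : ℂ) • (J k *ᵥ Y₁ l k y l) =
    (V - W) *ᵥ Y₀ l k y 0 + (V + W) *ᵥ (J k *ᵥ Y₁ l k y 0)

section Linearity

theorem der_add {l : ℝ} (hl : 0 < l) {n j : ℕ} (hj : j ≤ n) {y z : ℝ → ℂ}
    (hy : ContDiffOn ℝ (n : WithTop ℕ∞) y (Icc 0 l))
    (hz : ContDiffOn ℝ (n : WithTop ℕ∞) z (Icc 0 l)) {x : ℝ} (hx : x ∈ Icc 0 l) :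
    der l j (y + z) x = der l j y x + der l j z x := by
  have hj' : (j : WithTop ℕ∞) ≤ (n : WithTop ℕ∞) := by exact_mod_cast hj
  exact iteratedDerivWithin_add hx (uniqueDiffOn_Icc hl) ((hy x hx).of_le hj')
    ((hz x hx).of_le hj')

theorem der_smul {l : ℝ} (j : ℕ) (c : ℂ) (y : ℝ → ℂ) :
    der l j (c • y) = c • der l j y := by
  funext x
  exact iteratedDerivWithin_const_smul_field c y

theorem der_congr {l : ℝ} (j : ℕ) {y z : ℝ → ℂ} (h : EqOn y z (Icc 0 l)) :
    EqOn (der l j y) (der l j z) (Icc 0 l) :=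
  iteratedDerivWithin_congr h

theorem acOn_congr {l : ℝ} (hl : 0 < l) {f g : ℝ → ℂ} (h : EqOn f g (Icc 0 l))
    (hf : AbsolutelyContinuousOnInterval f 0 l) : AbsolutelyContinuousOnInterval g 0 l := by
  rw [absolutelyContinuousOnInterval_iff] at hf ⊢
  intro ε hε
  obtain ⟨δ, hδ, H⟩ := hf ε hε
  refine ⟨δ, hδ, fun E hE hlen => ?_⟩
  have key := H E hE hlen
  have hmem := hE.1
  rw [uIcc_of_le hl.le] at hmem
  convert key using 1
  refine Finset.sum_congr rfl fun i hi => ?_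
  rw [h (hmem i hi).1, h (hmem i hi).2]

theorem ae_differentiable {l : ℝ} (hl : 0 < l) {f : ℝ → ℂ}
    (hf : AbsolutelyContinuousOnInterval f 0 l) :
    ∀ᵐ x ∂(vol l), DifferentiableWithinAt ℝ f (Icc 0 l) x := by
  have hb := hf.boundedVariationOn.locallyBoundedVariationOn
  rw [uIcc_of_le hl.le] at hb
  exact ae_restrict_of_ae_restrict_of_subset Ioo_subset_Icc_self
    (hb.ae_differentiableWithinAt measurableSet_Icc)

theorem der_succ_add_ae {l : ℝ} (hl : 0 < l) {n : ℕ} {y z : ℝ → ℂ}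
    (hy : IsSobolevSucc l n y) (hz : IsSobolevSucc l n z) :
    der l (n + 1) (y + z) =ᵐ[vol l] der l (n + 1) y + der l (n + 1) z := by
  filter_upwards [ae_differentiable hl hy.absolutelyContinuous,
    ae_differentiable hl hz.absolutelyContinuous, ae_restrict_mem measurableSet_Ioo]
    with x h1 h2 hx
  have hx' : x ∈ Icc 0 l := Ioo_subset_Icc_self hx
  have e : EqOn (der l n (y + z)) (der l n y + der l n z) (Icc 0 l) := fun t ht =>
    der_add hl le_rfl hy.contDiffOn hz.contDiffOn ht
  simp only [der, iteratedDerivWithin_succ, Pi.add_apply] at h1 h2 e ⊢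
  rw [derivWithin_congr e (e hx'), derivWithin_add h1 h2]

theorem IsSobolevSucc.zero (l : ℝ) (n : ℕ) : IsSobolevSucc l n 0 := by
  have h : ∀ j, der l j 0 = 0 := fun j => by
    have := der_smul (l := l) j 0 0
    simpa using this
  refine ⟨contDiffOn_const, ?_, ?_⟩
  · rw [h, absolutelyContinuousOnInterval_iff]
    intro ε hε
    exact ⟨1, one_pos, fun E _ _ => by simpa using hε⟩
  · rw [h]
    exact MemLp.zero

theorem IsSobolevSucc.add {l : ℝ} (hl : 0 < l) {n : ℕ} {y z : ℝ → ℂ}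
    (hy : IsSobolevSucc l n y) (hz : IsSobolevSucc l n z) : IsSobolevSucc l n (y + z) where
  contDiffOn := hy.contDiffOn.add hz.contDiffOn
  absolutelyContinuous := acOn_congr hl
    (fun _ ht => (der_add hl le_rfl hy.contDiffOn hz.contDiffOn ht).symm)
    (hy.absolutelyContinuous.add hz.absolutelyContinuous)
  memLp := (hy.memLp.add hz.memLp).ae_eq (der_succ_add_ae hl hy hz).symm

theorem IsSobolevSucc.smul {l : ℝ} {n : ℕ} (c : ℂ) {y : ℝ → ℂ}
    (hy : IsSobolevSucc l n y) : IsSobolevSucc l n (c • y) where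
  contDiffOn := hy.contDiffOn.const_smul c
  absolutelyContinuous := by
    rw [der_smul]
    exact hy.absolutelyContinuous.const_smul c
  memLp := by
    rw [der_smul]
    exact hy.memLp.const_smul c

theorem BoundaryCond.zero (l : ℝ) (k : ℕ) (θ : ℂ) (V W : Matrix (Fin k) (Fin k) ℂ) :
    BoundaryCond l k θ V W 0 := by
  have h : ∀ j, der l j 0 = 0 := fun j => by
    have := der_smul (l := l) j 0 0
    simpa using this
  have h0 : ∀ x, Y₀ l k 0 x = 0 := fun x => by funext j; simp [Y₀, h]
  have h1 : ∀ x, Y₁ l k 0 x = 0 := fun x => by funext j; simp [Y₁, h]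
  constructor <;> simp [h, h0, h1]

theorem BoundaryCond.add {l : ℝ} (hl : 0 < l) {k : ℕ} {θ : ℂ}
    {V W : Matrix (Fin k) (Fin k) ℂ} {y z : ℝ → ℂ}
    (hys : IsSobolevSucc l (2 * k) y) (hzs : IsSobolevSucc l (2 * k) z)
    (hy : BoundaryCond l k θ V W y) (hz : BoundaryCond l k θ V W z) :
    BoundaryCond l k θ V W (y + z) := by
  have h : ∀ j ≤ 2 * k, ∀ x ∈ Icc 0 l, der l j (y + z) x = der l j y x + der l j z x :=
    fun j hj x hx => der_add hl hj hys.contDiffOn hzs.contDiffOn hx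
  have h0 : ∀ x ∈ Icc 0 l, Y₀ l k (y + z) x = Y₀ l k y x + Y₀ l k z x := fun x hx => by
    funext j
    exact h _ (by omega) x hx
  have h1 : ∀ x ∈ Icc 0 l, Y₁ l k (y + z) x = Y₁ l k y x + Y₁ l k z x := fun x hx => by
    funext j
    exact h _ (by omega) x hx
  have m0 : (0 : ℝ) ∈ Icc 0 l := ⟨le_rfl, hl.le⟩
  have ml : l ∈ Icc 0 l := ⟨hl.le, le_rfl⟩
  constructor
  · rw [h k (by omega) l ml, h k (by omega) 0 m0, hy.mid, hz.mid]
    ring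
  · rw [h0 l ml, h0 0 m0, h1 0 m0, smul_add, hy.fst, hz.fst]
    simp only [Matrix.mulVec_add]
    abel
  · rw [h1 l ml, h0 0 m0, h1 0 m0, Matrix.mulVec_add, smul_add, hy.snd, hz.snd]
    simp only [Matrix.mulVec_add]
    abel

theorem BoundaryCond.smul {l : ℝ} {k : ℕ} {θ : ℂ}
    {V W : Matrix (Fin k) (Fin k) ℂ} (c : ℂ) {y : ℝ → ℂ}
    (hy : BoundaryCond l k θ V W y) : BoundaryCond l k θ V W (c • y) := by
  have h0 : ∀ x, Y₀ l k (c • y) x = c • Y₀ l k y x := fun x => by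
    funext j; simp [Y₀, der_smul]
  have h1 : ∀ x, Y₁ l k (c • y) x = c • Y₁ l k y x := fun x => by
    funext j; simp [Y₁, der_smul]
  constructor
  · simp only [der_smul, Pi.smul_apply, smul_eq_mul, hy.mid]
    ring
  · rw [h0, h0, h1, smul_comm, hy.fst]
    simp only [Matrix.mulVec_smul, smul_add]
  · rw [h1, h0, h1, Matrix.mulVec_smul, smul_comm, hy.snd]
    simp only [Matrix.mulVec_smul, smul_add]

end Linearity

/-- The graph of `(-iD)ᵖ`, `p = 2 * k + 1`, with the boundary conditions `BoundaryCond`: the pairs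
of classes of `y` and `(-i)ᵖ y⁽ᵖ⁾` for `y` in `W₂ᵖ(0, l)` that satisfies them. -/
noncomputable def opGraph (l : ℝ) (hl : 0 < l) (k : ℕ) (θ : ℂ)
    (V W : Matrix (Fin k) (Fin k) ℂ) : Submodule ℂ (L2 l × L2 l) where
  carrier := {q | ∃ y : ℝ → ℂ, IsSobolevSucc l (2 * k) y ∧ BoundaryCond l k θ V W y ∧
    q.1 =ᵐ[vol l] y ∧
    q.2 =ᵐ[vol l] fun x => (-Complex.I) ^ (2 * k + 1) * der l (2 * k + 1) y x}
  zero_mem' := by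
    refine ⟨0, IsSobolevSucc.zero l _, BoundaryCond.zero l k θ V W, Lp.coeFn_zero _ _ _, ?_⟩
    have h : der l (2 * k + 1) 0 = 0 := by
      have := der_smul (l := l) (2 * k + 1) 0 0
      simpa using this
    filter_upwards [Lp.coeFn_zero ℂ 2 (vol l)] with x hx
    rw [h]
    simpa using hx
  add_mem' := by
    rintro ⟨f, g⟩ ⟨f', g'⟩ ⟨y, hy, bc, hf, hg⟩ ⟨z, hz, bz, hf', hg'⟩
    refine ⟨y + z, hy.add hl hz, bc.add hl hy hz bz, ?_, ?_⟩
    · exact (Lp.coeFn_add f f').trans (hf.add hf')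
    · refine (Lp.coeFn_add g g').trans ?_
      filter_upwards [hg, hg', der_succ_add_ae hl hy hz] with x h1 h2 h3
      simp only [Pi.add_apply] at h1 h2 h3 ⊢
      rw [h1, h2, h3]
      ring
  smul_mem' := by
    rintro c ⟨f, g⟩ ⟨y, hy, bc, hf, hg⟩
    refine ⟨c • y, hy.smul c, bc.smul c, ?_, ?_⟩
    · exact (Lp.coeFn_smul c f).trans (hf.const_smul c)
    · refine (Lp.coeFn_smul c g).trans ?_
      filter_upwards [hg] with x h1
      simp only [Pi.smul_apply, smul_eq_mul, der_smul] at h1 ⊢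
      rw [h1]
      ring

/-- The unbounded operator `(-iD)ᵖ`, `p = 2 * k + 1`, in `L²(0, l)` whose domain consists of the
functions in `W₂ᵖ(0, l)` that satisfy the boundary conditions. -/
noncomputable def op (l : ℝ) (hl : 0 < l) (k : ℕ) (θ : ℂ)
    (V W : Matrix (Fin k) (Fin k) ℂ) : L2 l →ₗ.[ℂ] L2 l :=
  (opGraph l hl k θ V W).toLinearPMap

/-- `opGraph` is single-valued, so `op` is the operator with this graph. -/
theorem op_graph (l : ℝ) (hl : 0 < l) (k : ℕ) (θ : ℂ) (V W : Matrix (Fin k) (Fin k) ℂ) :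
    (op l hl k θ V W).graph = opGraph l hl k θ V W := by
  refine Submodule.toLinearPMap_graph_eq _ ?_
  rintro ⟨f, g⟩ ⟨y, hy, -, hf, hg⟩ hx
  change f = 0 at hx
  change g = 0
  subst hx
  have h0 : y =ᵐ[vol l] (fun _ => (0 : ℂ)) := hf.symm.trans (Lp.coeFn_zero _ _ _)
  have hc := hy.contDiffOn.continuousOn
  have e0 : EqOn y 0 (Ioo 0 l) :=
    Measure.eqOn_Ioo_of_ae_eq volume h0 (hc.mono Ioo_subset_Icc_self) continuousOn_const
  have e : EqOn y 0 (Icc 0 l) := by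
    refine e0.of_subset_closure hc continuousOn_const Ioo_subset_Icc_self ?_
    rw [closure_Ioo hl.ne]
  have hd : der l (2 * k + 1) 0 = 0 := by
    have := der_smul (l := l) (2 * k + 1) 0 0
    simpa using this
  refine (Lp.eq_zero_iff_ae_eq_zero).2 ?_
  filter_upwards [hg, ae_restrict_mem measurableSet_Ioo] with x h1 hx
  change g x = _ at h1
  rw [h1, der_congr (2 * k + 1) e (Ioo_subset_Icc_self hx), hd]
  simp

end OddBVP

/-! Put `c = (-i)^p`. Since `p` is odd, `conj c = -c`, and Green's formula (`green`,
`inner_sub_inner`) turns the defect of symmetry into the difference of a boundary form at `l` and at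
`0`. With `b± = Y₀ ± J Y₁` this form is diagonal: twice it is `⟨b₊, b₊⟩ - ⟨b₋, b₋⟩` plus `2(-1)^k`
times the middle term (`two_mul_bform`). The boundary conditions decouple into `b₊(l) = V b₊(0)`,
`b₋(l) = W b₋(0)` and multiplication of `y^(k)` by `θ` (`boundaryCond_iff`). All three maps are
unitary, so the form takes equal values at both ends and the operator is symmetric.

Conversely, let `(f, g)` lie in the adjoint relation, and let `u` be a `p`-fold primitive of `g /
c`. Testing with functions whose derivatives of order at most `2k` vanish at both ends shows that `f
- u` is orthogonal to everything orthogonal to the polynomials of degree at most `2k`, hence is such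
a polynomial (`exists_of_mem_orthogonal_polySpace`). So `f` is regular and `g = c f^(p)`. As the
data at `0` of domain elements are arbitrary, `f` satisfies the boundary conditions
(`boundaryCond_of_forall_bform`). Density then follows from `opGraph_adjoint`. -/

namespace OddBVP

/-! ### Absolutely continuous complex functions and the fundamental theorem of calculus. -/

section AbsoluteContinuity

theorem acOn_const (c : ℂ) (a b : ℝ) : AbsolutelyContinuousOnInterval (fun _ : ℝ => c) a b :=
  contDiffOn_const.absolutelyContinuousOnInterval

theorem acOn_ofReal {f : ℝ → ℝ} {a b : ℝ} (hf : AbsolutelyContinuousOnInterval f a b) :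
    AbsolutelyContinuousOnInterval (fun x => (f x : ℂ)) a b := by
  rw [absolutelyContinuousOnInterval_iff] at hf ⊢
  simpa [Complex.dist_eq, Real.dist_eq, ← Complex.ofReal_sub] using hf

theorem acOn_conj {f : ℝ → ℂ} {a b : ℝ} (hf : AbsolutelyContinuousOnInterval f a b) :
    AbsolutelyContinuousOnInterval (fun x => starRingEnd ℂ (f x)) a b := by
  rw [absolutelyContinuousOnInterval_iff] at hf ⊢
  simpa [Complex.dist_conj_conj] using hf

theorem acOn_sum {ι : Type*} (s : Finset ι) {f : ι → ℝ → ℂ} {a b : ℝ}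
    (hf : ∀ i ∈ s, AbsolutelyContinuousOnInterval (f i) a b) :
    AbsolutelyContinuousOnInterval (fun x => ∑ i ∈ s, f i x) a b := by
  classical
  induction s using Finset.induction_on with
  | empty => simpa using acOn_const 0 a b
  | insert i s hi ih =>
    simp only [Finset.sum_insert hi]
    exact (hf i (Finset.mem_insert_self _ _)).add
      (ih fun j hj => hf j (Finset.mem_insert_of_mem hj))

theorem acOn_integral {f : ℝ → ℂ} {a b : ℝ} (h : IntervalIntegrable f volume a b) :
    AbsolutelyContinuousOnInterval (fun x => ∫ t in a..x, f t) a b := by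
  have hre : IntervalIntegrable (fun t => (f t).re) volume a b := ⟨h.1.re, h.2.re⟩
  have him : IntervalIntegrable (fun t => (f t).im) volume a b := ⟨h.1.im, h.2.im⟩
  have key := (acOn_ofReal
    (hre.absolutelyContinuousOnInterval_intervalIntegral left_mem_uIcc)).add
    ((acOn_ofReal
      (him.absolutelyContinuousOnInterval_intervalIntegral left_mem_uIcc)).const_smul Complex.I)
  rw [absolutelyContinuousOnInterval_iff] at key ⊢
  intro ε hε
  obtain ⟨δ, hδ, H⟩ := key ε hε
  refine ⟨δ, hδ, fun E hE hlen => ?_⟩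
  -- Absolute continuity only sees values on the interval, so the splitting into real and imaginary
  -- parts is needed there alone.
  have e : ∀ x ∈ uIcc a b, ∫ t in a..x, f t =
      ((fun x => ((∫ t in a..x, (f t).re : ℝ) : ℂ)) +
        fun x => Complex.I • ((∫ t in a..x, (f t).im : ℝ) : ℂ)) x := fun x hx => by
    have hi : IntervalIntegrable f volume a x :=
      h.mono_set (uIcc_subset_uIcc left_mem_uIcc hx)
    have hr' : IntervalIntegrable (fun t => ((f t).re : ℂ)) volume a x :=
      ⟨hi.1.re.ofReal, hi.2.re.ofReal⟩
    have hm' : IntervalIntegrable (fun t => ((f t).im : ℂ)) volume a x :=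
      ⟨hi.1.im.ofReal, hi.2.im.ofReal⟩
    simp only [Pi.add_apply, smul_eq_mul]
    rw [← intervalIntegral.integral_ofReal, ← intervalIntegral.integral_ofReal,
      ← intervalIntegral.integral_const_mul, ← intervalIntegral.integral_add hr' (hm'.const_mul _)]
    refine intervalIntegral.integral_congr fun t _ => ?_
    rw [mul_comm, Complex.re_add_im]
  convert H E hE hlen using 1
  refine Finset.sum_congr rfl fun i hi => ?_
  rw [e _ (hE.1 i hi).1, e _ (hE.1 i hi).2]

/-- The fundamental theorem of calculus for absolutely continuous functions. -/
theorem integral_eq_sub_of_acOn {l : ℝ} (hl : 0 < l) {F F' : ℝ → ℂ}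
    (hF : AbsolutelyContinuousOnInterval F 0 l)
    (hd : ∀ᵐ x ∂(vol l), HasDerivAt F (F' x) x) (hi : Integrable F' (vol l)) :
    ∫ x, F' x ∂(vol l) = F l - F 0 := by
  have hi' : IntervalIntegrable F' volume 0 l :=
    (intervalIntegrable_iff_integrableOn_Ioo_of_le hl.le).2 hi
  have hd' : ∀ᵐ x, x ∈ uIcc 0 l → HasDerivAt F (F' x) x := by
    rw [ae_restrict_iff' measurableSet_Ioo] at hd
    have h0 : ∀ᵐ x : ℝ, x ≠ 0 := by simp [ae_iff]
    have h1 : ∀ᵐ x : ℝ, x ≠ l := by simp [ae_iff]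
    filter_upwards [hd, h0, h1] with x hx hx0 hx1 hm
    rw [uIcc_of_le hl.le] at hm
    exact hx ⟨lt_of_le_of_ne hm.1 hx0.symm, lt_of_le_of_ne hm.2 hx1⟩
  -- `F` minus the integral of `F'` is absolutely continuous with derivative zero almost everywhere,
  -- hence constant.
  obtain ⟨C, hC⟩ := (hF.sub (acOn_integral hi')).const_of_ae_hasDerivAt_zero (by
    filter_upwards [hd', hi'.ae_hasDerivAt_integral] with x h1 h2 hx
    simpa using (h1 hx).sub (h2 hx 0 left_mem_uIcc))
  have e0 := hC 0 left_mem_uIcc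
  have e1 := hC l right_mem_uIcc
  simp only [Pi.sub_apply, intervalIntegral.integral_same, sub_zero] at e0 e1
  rw [← e0, intervalIntegral.integral_of_le hl.le, integral_Ioc_eq_integral_Ioo] at e1
  rw [← e1]
  ring

end AbsoluteContinuity

/-! ### Sobolev functions with prescribed top derivative or prescribed end-point data. -/

section Construction

theorem der_succ (l : ℝ) (j : ℕ) (y : ℝ → ℂ) :
    der l (j + 1) y = derivWithin (der l j y) (Icc 0 l) :=
  iteratedDerivWithin_succ

/-- One-sided derivatives on `[0, l]` are unique, so a chain of candidates `v j` must be the chain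
of derivatives. Only the last link is allowed to hold merely almost everywhere. -/
theorem isSobolevSucc_of_hasDeriv {l : ℝ} (hl : 0 < l) {n : ℕ} (v : ℕ → ℝ → ℂ)
    (h : ∀ j < n, ∀ x ∈ Icc 0 l, HasDerivWithinAt (v j) (v (j + 1) x) (Icc 0 l) x)
    (hac : AbsolutelyContinuousOnInterval (v n) 0 l)
    (hae : ∀ᵐ x ∂(vol l), HasDerivAt (v n) (v (n + 1) x) x)
    (hL : MemLp (v (n + 1)) 2 (vol l)) :
    IsSobolevSucc l n (v 0) ∧ (∀ j ≤ n, EqOn (der l j (v 0)) (v j) (Icc 0 l)) ∧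
      der l (n + 1) (v 0) =ᵐ[vol l] v (n + 1) := by
  have hu := uniqueDiffOn_Icc hl
  have e : ∀ j ≤ n, EqOn (der l j (v 0)) (v j) (Icc 0 l) := by
    intro j
    induction j with
    | zero => intro _ x _; simp [der]
    | succ j ih =>
      intro hj x hx
      have ih' := ih (by omega)
      rw [der_succ, derivWithin_congr ih' (ih' hx)]
      exact (h j (by omega) x hx).derivWithin (hu x hx)
  have ht : der l (n + 1) (v 0) =ᵐ[vol l] v (n + 1) := by
    filter_upwards [hae, ae_restrict_mem measurableSet_Ioo] with x h1 hx
    have hx' := Ioo_subset_Icc_self hx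
    rw [der_succ, derivWithin_congr (e n le_rfl) (e n le_rfl hx')]
    exact h1.hasDerivWithinAt.derivWithin (hu x hx')
  refine ⟨⟨?_, acOn_congr hl (e n le_rfl).symm hac, hL.ae_eq ht.symm⟩, e, ht⟩
  rw [contDiffOn_nat_iff_continuousOn_differentiableOn_deriv hu]
  constructor
  · intro m hm
    refine ContinuousOn.congr ?_ (e m hm)
    rcases hm.lt_or_eq with hm | rfl
    · exact fun x hx => (h m hm x hx).continuousWithinAt
    · simpa [uIcc_of_le hl.le] using hac.continuousOn
  · intro m hm
    exact DifferentiableOn.congr (fun x hx => (h m hm x hx).differentiableWithinAt) (e m hm.le)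

theorem intervalIntegrable_of_memLp {l : ℝ} (hl : 0 < l) {g : ℝ → ℂ} (hg : MemLp g 2 (vol l)) :
    IntervalIntegrable g volume 0 l :=
  (intervalIntegrable_iff_integrableOn_Ioo_of_le hl.le).2 (hg.integrable (by norm_num))

theorem memLp_of_continuousOn {l : ℝ} {f : ℝ → ℂ} (hf : ContinuousOn f (Icc 0 l)) :
    MemLp f 2 (vol l) := by
  obtain ⟨C, hC⟩ := isCompact_Icc.exists_bound_of_continuousOn hf
  refine MemLp.of_bound ((hf.mono Ioo_subset_Icc_self).aestronglyMeasurable measurableSet_Ioo) C ?_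
  filter_upwards [ae_restrict_mem measurableSet_Ioo] with x hx
  exact hC x (Ioo_subset_Icc_self hx)

/-- Integrate `g` from `0` repeatedly, `n + 1` times. -/
theorem exists_isSobolevSucc_der_eq {l : ℝ} (hl : 0 < l) (n : ℕ) {g : ℝ → ℂ}
    (hg : MemLp g 2 (vol l)) :
    ∃ y, IsSobolevSucc l n y ∧ (∀ j ≤ n, der l j y 0 = 0) ∧ der l (n + 1) y =ᵐ[vol l] g := by
  let w : ℕ → ℝ → ℂ := fun m => (fun f x => ∫ t in (0 : ℝ)..x, f t)^[m] g
  have ws : ∀ m, w (m + 1) = fun x => ∫ t in (0 : ℝ)..x, w m t := fun m => by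
    simp only [w, Function.iterate_succ_apply']
  have hi := intervalIntegrable_of_memLp hl hg
  have hwi : ∀ m, IntervalIntegrable (w m) volume 0 l ∧
      AbsolutelyContinuousOnInterval (w (m + 1)) 0 l := by
    intro m
    induction m with
    | zero => exact ⟨hi, by rw [ws]; exact acOn_integral hi⟩
    | succ m ih =>
      have h1 : IntervalIntegrable (w (m + 1)) volume 0 l := ih.2.continuousOn.intervalIntegrable
      exact ⟨h1, by rw [ws]; exact acOn_integral h1⟩
  have hc : ∀ m, ContinuousOn (w (m + 1)) (Icc 0 l) := fun m => by
    simpa [uIcc_of_le hl.le] using (hwi m).2.continuousOn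
  -- Each derivative undoes one integration: `v 0` is the solution and `v (n + 1)` is `g`.
  let v : ℕ → ℝ → ℂ := fun j => w (n + 1 - j)
  obtain ⟨h1, h2, h3⟩ := isSobolevSucc_of_hasDeriv hl (n := n) v (by
    intro j hj x hx
    obtain ⟨m, rfl⟩ : ∃ m, n = j + 1 + m := ⟨n - (j + 1), by omega⟩
    simp only [v]
    rw [show j + 1 + m + 1 - j = m + 1 + 1 by omega,
      show j + 1 + m + 1 - (j + 1) = m + 1 by omega, ws (m + 1)]
    have : Fact (x ∈ Icc 0 l) := ⟨hx⟩
    refine intervalIntegral.integral_hasDerivWithinAt_right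
      ((hwi (m + 1)).1.mono_set (uIcc_subset_uIcc left_mem_uIcc (by rwa [uIcc_of_le hl.le])))
      ?_ (hc m x hx)
    exact (hc m).stronglyMeasurableAtFilter_nhdsWithin measurableSet_Icc x)
    (by simpa [v] using (hwi 0).2)
    (by
      simp only [v, show n + 1 - n = 0 + 1 by omega, show n + 1 - (n + 1) = 0 by omega, ws 0]
      refine (ae_restrict_iff' measurableSet_Ioo).2 ?_
      filter_upwards [hi.ae_hasDerivAt_integral] with x hx hm
      exact hx (by rw [uIcc_of_le hl.le]; exact Ioo_subset_Icc_self hm) 0 left_mem_uIcc)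
    (by simpa [v, w] using hg)
  refine ⟨v 0, h1, fun j hj => ?_, by simpa [v, w] using h3⟩
  rw [h2 j hj ⟨le_rfl, hl.le⟩]
  simp only [v]
  rw [show n + 1 - j = (n - j) + 1 by omega, ws]
  simp

theorem isSobolevSucc_of_contDiff {l : ℝ} (hl : 0 < l) (n : ℕ) {y : ℝ → ℂ}
    (hy : ContDiff ℝ ((n + 1 : ℕ) : WithTop ℕ∞) y) : IsSobolevSucc l n y := by
  have hd : ∀ j ≤ n, ∀ x, HasDerivAt (iteratedDeriv j y) (iteratedDeriv (j + 1) y x) x := by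
    intro j hj x
    rw [iteratedDeriv_succ]
    exact (hy.differentiable_iteratedDeriv j (by exact_mod_cast (by omega : j < n + 1)) x).hasDerivAt
  have hc := hy.continuous_iteratedDeriv (n + 1) (by norm_cast)
  have := (isSobolevSucc_of_hasDeriv hl (n := n) (fun j => iteratedDeriv j y)
    (fun j hj x _ => (hd j hj.le x).hasDerivWithinAt)
    (ContDiffOn.absolutelyContinuousOnInterval (ContDiff.contDiffOn (by
      refine contDiff_one_iff_deriv.2 ⟨fun x => (hd n le_rfl x).differentiableAt, ?_⟩
      rw [← iteratedDeriv_succ]; exact hc)))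
    (Filter.Eventually.of_forall fun x => hd n le_rfl x)
    (memLp_of_continuousOn hc.continuousOn)).1
  simpa using this

/-- The restriction of a complex polynomial to the real line. -/
noncomputable def polyFun (q : Polynomial ℂ) (x : ℝ) : ℂ := q.eval (x : ℂ)

theorem hasDerivAt_polyFun (q : Polynomial ℂ) (x : ℝ) :
    HasDerivAt (polyFun q) (polyFun q.derivative x) x :=
  (q.hasDerivAt (x : ℂ)).comp_ofReal

theorem contDiff_polyFun (q : Polynomial ℂ) {n : WithTop ℕ∞} : ContDiff ℝ n (polyFun q) := by
  have h : ContDiff ℝ n fun z : ℂ => q.eval z := by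
    simpa [Polynomial.coe_aeval_eq_eval] using
      (q.contDiff_aeval (𝕜 := ℂ) n).restrict_scalars ℝ
  exact h.comp Complex.ofRealCLM.contDiff

theorem der_polyFun {l : ℝ} (hl : 0 < l) (q : Polynomial ℂ) (j : ℕ) :
    EqOn (der l j (polyFun q)) (polyFun (Polynomial.derivative^[j] q)) (Icc 0 l) := by
  induction j with
  | zero => intro x _; simp [der]
  | succ j ih =>
    intro x hx
    rw [der_succ, derivWithin_congr ih (ih hx), Function.iterate_succ_apply']
    exact (hasDerivAt_polyFun _ x).hasDerivWithinAt.derivWithin (uniqueDiffOn_Icc hl x hx)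

/-- This is the Taylor polynomial `∑ dᵢ (X - a)^i / i!`. -/
theorem exists_polynomial_derivative_eq (n : ℕ) (a : ℂ) (d : ℕ → ℂ) :
    ∃ q ∈ Polynomial.degreeLT ℂ (n + 1),
      ∀ j ≤ n, (Polynomial.derivative^[j] q).eval a = d j := by
  let r : Polynomial ℂ :=
    ∑ i ∈ Finset.range (n + 1), Polynomial.monomial i (d i / (i.factorial : ℂ))
  have hr : r.degree < (n + 1 : ℕ) := by
    refine (Polynomial.degree_sum_le _ _).trans_lt ?_
    rw [Finset.sup_lt_iff (by exact WithBot.bot_lt_coe _)]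
    intro i hi
    exact (Polynomial.degree_monomial_le _ _).trans_lt
      (by exact_mod_cast Finset.mem_range.1 hi)
  refine ⟨Polynomial.taylor (-a) r, Polynomial.mem_degreeLT.2 ?_, fun j hj => ?_⟩
  · rwa [Polynomial.degree_taylor]
  · rw [← Polynomial.factorial_smul_hasseDeriv, LinearMap.smul_apply, Polynomial.eval_smul,
      ← Polynomial.taylor_coeff, Polynomial.taylor_taylor]
    simp only [add_neg_cancel, Polynomial.taylor_zero, r, Polynomial.finsetSum_coeff, Polynomial.coeff_monomial]
    rw [Finset.sum_ite_eq' , if_pos (Finset.mem_range.2 (by omega)), nsmul_eq_mul]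
    have : (j.factorial : ℂ) ≠ 0 := by exact_mod_cast j.factorial_ne_zero
    field_simp

/-- Derivatives at both end points can be prescribed. -/
theorem exists_isSobolevSucc_der_endpoints {l : ℝ} (hl : 0 < l) (n : ℕ) (d₀ d₁ : ℕ → ℂ) :
    ∃ y, IsSobolevSucc l n y ∧ ∀ j ≤ n, der l j y 0 = d₀ j ∧ der l j y l = d₁ j := by
  obtain ⟨p, -, hp⟩ := exists_polynomial_derivative_eq n (0 : ℝ) d₀
  obtain ⟨q, -, hq⟩ := exists_polynomial_derivative_eq n l d₁
  -- `φ` is `0` for `x ≤ l / 3` and `1` for `x ≥ 2l / 3`, so the blend equals `p` near `0` and `q`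
  -- near `l`.
  let φ : ℝ → ℝ := fun x => Real.smoothTransition (3 * x / l - 1)
  have hφ : ContDiff ℝ ((n + 1 : ℕ) : WithTop ℕ∞) φ :=
    Real.smoothTransition.contDiff.comp (by fun_prop)
  have h0 : (fun x => polyFun p x + φ x • (polyFun q x - polyFun p x)) =ᶠ[nhds 0] polyFun p := by
    filter_upwards [Iio_mem_nhds (show (0 : ℝ) < l / 3 by positivity)] with x hx
    have : φ x = 0 := Real.smoothTransition.zero_of_nonpos (by
      rw [sub_nonpos, div_le_one hl]; have := mem_Iio.1 hx; linarith)
    simp [this]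
  have h1 : (fun x => polyFun p x + φ x • (polyFun q x - polyFun p x)) =ᶠ[nhds l] polyFun q := by
    filter_upwards [Ioi_mem_nhds (show 2 * l / 3 < l by linarith)] with x hx
    have : φ x = 1 := Real.smoothTransition.one_of_one_le (by
      rw [le_sub_iff_add_le, le_div_iff₀ hl]; have := mem_Ioi.1 hx; linarith)
    simp [this]
  refine ⟨fun x => polyFun p x + φ x • (polyFun q x - polyFun p x),
    isSobolevSucc_of_contDiff hl n ((contDiff_polyFun p).add
      (hφ.smul ((contDiff_polyFun q).sub (contDiff_polyFun p)))), fun j hj => ⟨?_, ?_⟩⟩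
  · rw [der, ((h0.filter_mono nhdsWithin_le_nhds).iteratedDerivWithin_eq h0.self_of_nhds)]
    exact (der_polyFun hl p j ⟨le_rfl, hl.le⟩).trans (hp j hj)
  · rw [der, ((h1.filter_mono nhdsWithin_le_nhds).iteratedDerivWithin_eq h1.self_of_nhds)]
    exact (der_polyFun hl q j ⟨hl.le, le_rfl⟩).trans (hq j hj)

end Construction

/-! ### Green's formula. -/

section Green

/-- The boundary form of `D ^ (n + 1)`. -/
noncomputable def bform (l : ℝ) (n : ℕ) (y z : ℝ → ℂ) (x : ℝ) : ℂ :=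
  ∑ j ∈ Finset.range (n + 1), (-1) ^ j * (der l (n - j) y x * starRingEnd ℂ (der l j z x))

/-- The sum telescopes; it is the derivative of `bform` by the product rule. -/
theorem sum_alternating_leibniz (n : ℕ) (a b : ℕ → ℂ) :
    ∑ j ∈ Finset.range (n + 1), (-1) ^ j * (a (n - j + 1) * b j + a (n - j) * b (j + 1)) =
      a (n + 1) * b 0 + (-1) ^ n * (a 0 * b (n + 1)) := by
  have key : ∀ m ≤ n + 1,
      ∑ j ∈ Finset.range m, (-1) ^ j * (a (n - j + 1) * b j + a (n - j) * b (j + 1)) =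
        a (n + 1) * b 0 - (-1) ^ m * (a (n + 1 - m) * b m) := by
    intro m
    induction m with
    | zero => intro _; simp
    | succ m ih =>
      intro hm
      rw [Finset.sum_range_succ, ih (by omega), show n + 1 - (m + 1) = n - m by omega,
        show n + 1 - m = n - m + 1 by omega]
      ring
  rw [key _ le_rfl]
  simp [pow_succ]

theorem IsSobolevSucc.acOn_der {l : ℝ} (hl : 0 < l) {n : ℕ} {y : ℝ → ℂ}
    (hy : IsSobolevSucc l n y) {j : ℕ} (hj : j ≤ n) :
    AbsolutelyContinuousOnInterval (der l j y) 0 l := by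
  rcases hj.lt_or_eq with hj | rfl
  · refine ContDiffOn.absolutelyContinuousOnInterval ?_
    rw [uIcc_of_le hl.le]
    exact ((contDiffOn_nat_succ_iff_contDiffOn_one_iteratedDerivWithin (uniqueDiffOn_Icc hl)).1
      (hy.contDiffOn.of_le (by exact_mod_cast hj))).2
  · exact hy.absolutelyContinuous

theorem IsSobolevSucc.hasDerivAt_der {l : ℝ} (hl : 0 < l) {n : ℕ} {y : ℝ → ℂ}
    (hy : IsSobolevSucc l n y) :
    ∀ᵐ x ∂(vol l), ∀ j ≤ n, HasDerivAt (der l j y) (der l (j + 1) y x) x := by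
  refine (ae_all_iff.2 fun j => ?_)
  by_cases hj : j ≤ n
  · filter_upwards [ae_differentiable hl (hy.acOn_der hl hj), ae_restrict_mem measurableSet_Ioo]
      with x h1 hx _
    have := h1.hasDerivWithinAt.hasDerivAt (Icc_mem_nhds hx.1 hx.2)
    rwa [der_succ]
  · exact Filter.Eventually.of_forall fun x h => absurd h hj

theorem IsSobolevSucc.memLp_self {l : ℝ} {n : ℕ} {y : ℝ → ℂ}
    (hy : IsSobolevSucc l n y) : MemLp y 2 (vol l) :=
  memLp_of_continuousOn hy.contDiffOn.continuousOn

theorem integrable_mul_conj {l : ℝ} {f g : ℝ → ℂ} (hf : MemLp f 2 (vol l))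
    (hg : MemLp g 2 (vol l)) : Integrable (fun x => f x * starRingEnd ℂ (g x)) (vol l) :=
  hf.integrable_mul hg.star

/-- Green's formula. -/
theorem green {l : ℝ} (hl : 0 < l) {n : ℕ} {y z : ℝ → ℂ}
    (hy : IsSobolevSucc l n y) (hz : IsSobolevSucc l n z) :
    (∫ x, der l (n + 1) y x * starRingEnd ℂ (z x) ∂(vol l)) +
      (-1) ^ n * ∫ x, y x * starRingEnd ℂ (der l (n + 1) z x) ∂(vol l) =
      bform l n y z l - bform l n y z 0 := by
  have i1 := integrable_mul_conj hy.memLp hz.memLp_self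
  have i2 := integrable_mul_conj hy.memLp_self hz.memLp
  rw [← integral_const_mul, ← integral_add i1 (i2.const_mul _)]
  refine integral_eq_sub_of_acOn hl (F := bform l n y z) ?_ ?_ (i1.add (i2.const_mul _))
  · refine acOn_sum _ fun j hj => ?_
    have hj' := Finset.mem_range.1 hj
    exact ((hy.acOn_der hl (j := n - j) (by omega)).smul
      (acOn_conj (hz.acOn_der hl (j := j) (by omega)))).const_smul ((-1 : ℂ) ^ j)
  · filter_upwards [hy.hasDerivAt_der hl, hz.hasDerivAt_der hl] with x h1 h2
    have key := sum_alternating_leibniz n (fun j => der l j y x)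
      (fun j => starRingEnd ℂ (der l j z x))
    simp only [show der l 0 y = y from iteratedDerivWithin_zero,
      show der l 0 z = z from iteratedDerivWithin_zero] at key
    rw [← key]
    refine HasDerivAt.fun_sum fun j hj => ?_
    have hj' := Finset.mem_range.1 hj
    have := ((h1 (n - j) (by omega)).mul (h2 j (by omega)).star).const_mul ((-1 : ℂ) ^ j)
    exact this

end Green

/-! ### Diagonalization of the boundary form and the boundary conditions. -/

section BoundarySpace

theorem J_mulVec (k : ℕ) (a : Fin k → ℂ) (i : Fin k) :
    (J k *ᵥ a) i = (-1) ^ (i : ℕ) * a i.rev := by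
  simp only [Matrix.mulVec, dotProduct, J, Matrix.of_apply, ite_mul, zero_mul]
  rw [Finset.sum_eq_single i.rev]
  · rw [if_pos (by rw [Fin.val_rev]; omega)]
  · intro b _ hb
    rw [if_neg]
    intro h
    exact hb (Fin.ext (by rw [Fin.val_rev]; omega))
  · simp

/-- The sum `Y₀ + J Y₁`. -/
noncomputable def bplus (l : ℝ) (k : ℕ) (y : ℝ → ℂ) (x : ℝ) : Fin k → ℂ :=
  Y₀ l k y x + J k *ᵥ Y₁ l k y x

/-- The difference `Y₀ - J Y₁`. -/
noncomputable def bminus (l : ℝ) (k : ℕ) (y : ℝ → ℂ) (x : ℝ) : Fin k → ℂ :=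
  Y₀ l k y x - J k *ᵥ Y₁ l k y x

theorem J_mulVec_Y₁ (l : ℝ) (k : ℕ) (y : ℝ → ℂ) (x : ℝ) (i : Fin k) :
    (J k *ᵥ Y₁ l k y x) i = (-1) ^ (i : ℕ) * der l (2 * k - i) y x := by
  have := i.2
  rw [J_mulVec, Y₁, Fin.val_rev, show k + 1 + (k - (i + 1)) = 2 * k - (i : ℕ) by omega]

/-- Split the sum at its middle index `k`. The signs in `J` absorb `(-1)^j` for `j < k`; the indices
above `k` are reflected by `j ↦ 2k - j`, which preserves the sign because `2k` is even. -/
theorem bform_eq (l : ℝ) (k : ℕ) (y z : ℝ → ℂ) (x : ℝ) :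
    bform l (2 * k) y z x = (J k *ᵥ Y₁ l k y x) ⬝ᵥ star (Y₀ l k z x) +
      Y₀ l k y x ⬝ᵥ star (J k *ᵥ Y₁ l k z x) +
      (-1) ^ k * (der l k y x * starRingEnd ℂ (der l k z x)) := by
  have h1 : (J k *ᵥ Y₁ l k y x) ⬝ᵥ star (Y₀ l k z x) = ∑ j ∈ Finset.range k,
      (-1) ^ j * (der l (2 * k - j) y x * starRingEnd ℂ (der l j z x)) := by
    rw [Finset.sum_range]
    refine Finset.sum_congr rfl fun i _ => ?_
    rw [J_mulVec_Y₁, mul_assoc]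
    rfl
  have h2 : Y₀ l k y x ⬝ᵥ star (J k *ᵥ Y₁ l k z x) = ∑ j ∈ Finset.range k,
      (-1) ^ j * (der l j y x * starRingEnd ℂ (der l (2 * k - j) z x)) := by
    rw [Finset.sum_range]
    refine Finset.sum_congr rfl fun i _ => ?_
    rw [Pi.star_apply, J_mulVec_Y₁, ← starRingEnd_apply, map_mul, map_pow, map_neg, map_one, Y₀]
    ring
  rw [h1, h2, bform, show 2 * k + 1 = k + 1 + k by omega, Finset.sum_range_add,
    Finset.sum_range_succ, show 2 * k - k = k by omega]
  have h3 : ∀ j ∈ Finset.range k,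
      (-1 : ℂ) ^ (k + 1 + (k - 1 - j)) * (der l (2 * k - (k + 1 + (k - 1 - j))) y x *
        starRingEnd ℂ (der l (k + 1 + (k - 1 - j)) z x)) =
      (-1) ^ j * (der l j y x * starRingEnd ℂ (der l (2 * k - j) z x)) := by
    intro j hj
    have hj' := Finset.mem_range.1 hj
    obtain ⟨m, rfl⟩ : ∃ m, k = j + 1 + m := ⟨k - (j + 1), by omega⟩
    rw [show j + 1 + m + 1 + (j + 1 + m - 1 - j) = 2 * (j + 1 + m) - j by omega,
      show 2 * (j + 1 + m) - (2 * (j + 1 + m) - j) = j by omega,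
      show 2 * (j + 1 + m) - j = j + 2 * (1 + m) by omega, pow_add, pow_mul]
    norm_num
  rw [← Finset.sum_congr rfl h3, Finset.sum_range_reflect
    (fun i => (-1 : ℂ) ^ (k + 1 + i) * (der l (2 * k - (k + 1 + i)) y x *
      starRingEnd ℂ (der l (k + 1 + i) z x))) k]
  ring

/-- Polarization of the two cross terms between `Y₀` and `J Y₁`. -/
theorem two_mul_bform (l : ℝ) (k : ℕ) (y z : ℝ → ℂ) (x : ℝ) :
    2 * bform l (2 * k) y z x = bplus l k y x ⬝ᵥ star (bplus l k z x) -
      bminus l k y x ⬝ᵥ star (bminus l k z x) +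
      2 * (-1) ^ k * (der l k y x * starRingEnd ℂ (der l k z x)) := by
  rw [bform_eq, bplus, bminus, bplus, bminus]
  simp only [star_add, star_sub, add_dotProduct, sub_dotProduct, dotProduct_add, dotProduct_sub]
  ring

/-- Adding the two vector conditions eliminates `W`, subtracting them eliminates `V`. -/
theorem boundaryCond_iff {l : ℝ} {k : ℕ} {θ : ℂ} {V W : Matrix (Fin k) (Fin k) ℂ} {y : ℝ → ℂ} :
    BoundaryCond l k θ V W y ↔ der l k y l = θ * der l k y 0 ∧
      bplus l k y l = V *ᵥ bplus l k y 0 ∧ bminus l k y l = W *ᵥ bminus l k y 0 := by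
  have two : ∀ {u v : Fin k → ℂ}, (2 : ℂ) • u = (2 : ℂ) • v → u = v := fun h =>
    smul_right_injective _ (two_ne_zero (α := ℂ)) h
  constructor
  · rintro ⟨h0, h1, h2⟩
    refine ⟨h0, two ?_, two ?_⟩
    · rw [bplus, bplus, smul_add, h1, h2]
      simp only [Matrix.add_mulVec, Matrix.sub_mulVec, Matrix.mulVec_add]
      module
    · rw [bminus, bminus, smul_sub, h1, h2]
      simp only [Matrix.add_mulVec, Matrix.sub_mulVec, Matrix.mulVec_sub]
      module
  · rintro ⟨h0, h1, h2⟩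
    refine ⟨h0, ?_, ?_⟩
    · have : (2 : ℂ) • Y₀ l k y l = bplus l k y l + bminus l k y l := by
        rw [bplus, bminus]; module
      rw [this, h1, h2, bplus, bminus]
      simp only [Matrix.add_mulVec, Matrix.sub_mulVec, Matrix.mulVec_add, Matrix.mulVec_sub]
      module
    · have : (2 : ℂ) • (J k *ᵥ Y₁ l k y l) = bplus l k y l - bminus l k y l := by
        rw [bplus, bminus]; module
      rw [this, h1, h2, bplus, bminus]
      simp only [Matrix.add_mulVec, Matrix.sub_mulVec, Matrix.mulVec_add, Matrix.mulVec_sub]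
      module

theorem dotProduct_star_mulVec {m : Type*} [Fintype m] (V : Matrix m m ℂ) (a b : m → ℂ) :
    a ⬝ᵥ star (V *ᵥ b) = (Vᴴ *ᵥ a) ⬝ᵥ star b := by
  rw [Matrix.star_mulVec, dotProduct_comm, ← Matrix.dotProduct_mulVec, dotProduct_comm]

theorem unitary_dotProduct {m : Type*} [Fintype m] [DecidableEq m] {V : Matrix m m ℂ}
    (hV : V ∈ Matrix.unitaryGroup m ℂ) (a b : m → ℂ) :
    (V *ᵥ a) ⬝ᵥ star (V *ᵥ b) = a ⬝ᵥ star b := by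
  have h : Vᴴ * V = 1 := Matrix.mem_unitaryGroup_iff'.1 hV
  rw [dotProduct_star_mulVec, Matrix.mulVec_mulVec, h, Matrix.one_mulVec]

theorem eq_unitary_mulVec {m : Type*} [Fintype m] [DecidableEq m] {V : Matrix m m ℂ}
    (hV : V ∈ Matrix.unitaryGroup m ℂ) {a b : m → ℂ}
    (h : ∀ s, a ⬝ᵥ star (V *ᵥ s) = b ⬝ᵥ star s) : a = V *ᵥ b := by
  have h' : V * Vᴴ = 1 := Matrix.mem_unitaryGroup_iff.1 hV
  have e : Vᴴ *ᵥ a = b := dotProduct_eq _ _ fun u => by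
    have := h (star u)
    rwa [dotProduct_star_mulVec, star_star] at this
  rw [← e, Matrix.mulVec_mulVec, h', Matrix.one_mulVec]

theorem theta_mul_conj {θ : ℂ} (hθ : ‖θ‖ = 1) : θ * starRingEnd ℂ θ = 1 := by
  rw [Complex.mul_conj, Complex.normSq_eq_norm_sq, hθ]
  simp

theorem BoundaryCond.bform_eq {l : ℝ} {k : ℕ} {θ : ℂ} (hθ : ‖θ‖ = 1)
    {V W : Matrix (Fin k) (Fin k) ℂ} (hV : V ∈ Matrix.unitaryGroup (Fin k) ℂ)
    (hW : W ∈ Matrix.unitaryGroup (Fin k) ℂ) {y z : ℝ → ℂ}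
    (hy : BoundaryCond l k θ V W y) (hz : BoundaryCond l k θ V W z) :
    bform l (2 * k) y z l = bform l (2 * k) y z 0 := by
  obtain ⟨y0, y1, y2⟩ := boundaryCond_iff.1 hy
  obtain ⟨z0, z1, z2⟩ := boundaryCond_iff.1 hz
  refine mul_left_cancel₀ (two_ne_zero (α := ℂ)) ?_
  rw [two_mul_bform, two_mul_bform, y0, y1, y2, z0, z1, z2, unitary_dotProduct hV,
    unitary_dotProduct hW, map_mul]
  linear_combination (2 * (-1) ^ k * (der l k y 0 * starRingEnd ℂ (der l k z 0))) *
    theta_mul_conj hθ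

/-- The derivatives of order at most `2 * k` with given `Y₀ + J Y₁`, `Y₀ - J Y₁` and middle
derivative. -/
noncomputable def jet (k : ℕ) (p q : Fin k → ℂ) (c : ℂ) (j : ℕ) : ℂ :=
  if h : j < k then (p ⟨j, h⟩ + q ⟨j, h⟩) / 2
  else if h' : 2 * k - j < k then
    (-1) ^ (2 * k - j) * (p ⟨2 * k - j, h'⟩ - q ⟨2 * k - j, h'⟩) / 2
  else c

/-- `jet` puts `(p + q) / 2` into `Y₀` and `(p - q) / 2` into `J Y₁`; its sign cancels the sign in
`J`. -/
theorem boundary_of_jet {l : ℝ} {k : ℕ} {y : ℝ → ℂ} {x : ℝ} {p q : Fin k → ℂ} {c : ℂ}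
    (h : ∀ j ≤ 2 * k, der l j y x = jet k p q c j) :
    bplus l k y x = p ∧ bminus l k y x = q ∧ der l k y x = c := by
  have h0 : ∀ i : Fin k, Y₀ l k y x i = (p i + q i) / 2 := fun i => by
    rw [Y₀, h _ (by have := i.2; omega), jet, dif_pos i.2]
  have h1 : ∀ i : Fin k, (J k *ᵥ Y₁ l k y x) i = (p i - q i) / 2 := fun i => by
    have hi := i.2
    have e : 2 * k - (2 * k - (i : ℕ)) = i := by omega
    rw [J_mulVec_Y₁, h _ (by omega), jet, dif_neg (by omega), dif_pos (by omega)]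
    simp only [e, Fin.eta]
    rw [mul_div_assoc, ← mul_assoc, ← mul_pow]
    norm_num
  refine ⟨?_, ?_, ?_⟩
  · funext i
    rw [bplus, Pi.add_apply, h0, h1]
    ring
  · funext i
    rw [bminus, Pi.sub_apply, h0, h1]
    ring
  · rw [h k (by omega), jet, dif_neg (by omega), dif_neg (by omega)]

/-- A function whose boundary form with all functions that satisfy the boundary conditions vanishes
satisfies the boundary conditions itself. -/
theorem boundaryCond_of_forall_bform {l : ℝ} (hl : 0 < l) {k : ℕ} {θ : ℂ} (hθ : ‖θ‖ = 1)
    {V W : Matrix (Fin k) (Fin k) ℂ} (hV : V ∈ Matrix.unitaryGroup (Fin k) ℂ)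
    (hW : W ∈ Matrix.unitaryGroup (Fin k) ℂ) {z : ℝ → ℂ}
    (hz : ∀ y, IsSobolevSucc l (2 * k) y → BoundaryCond l k θ V W y →
      bform l (2 * k) z y l = bform l (2 * k) z y 0) : BoundaryCond l k θ V W z := by
  -- The data `p, q, c` at `0` are free: the data at `l` forced by the conditions can be prescribed
  -- independently. Making all but one of `p, q, c` zero then isolates each condition.
  have key : ∀ (p q : Fin k → ℂ) (c : ℂ),
      bplus l k z l ⬝ᵥ star (V *ᵥ p) - bminus l k z l ⬝ᵥ star (W *ᵥ q) +
        2 * (-1) ^ k * (der l k z l * starRingEnd ℂ (θ * c)) =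
      bplus l k z 0 ⬝ᵥ star p - bminus l k z 0 ⬝ᵥ star q +
        2 * (-1) ^ k * (der l k z 0 * starRingEnd ℂ c) := by
    intro p q c
    obtain ⟨y, hy, hd⟩ := exists_isSobolevSucc_der_endpoints hl (2 * k) (jet k p q c)
      (jet k (V *ᵥ p) (W *ᵥ q) (θ * c))
    obtain ⟨a0, a1, a2⟩ := boundary_of_jet fun j hj => (hd j hj).1
    obtain ⟨b0, b1, b2⟩ := boundary_of_jet fun j hj => (hd j hj).2
    have bc : BoundaryCond l k θ V W y :=
      boundaryCond_iff.2 ⟨by rw [a2, b2], by rw [a0, b0], by rw [a1, b1]⟩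
    have := congrArg (2 * ·) (hz y hy bc)
    simp only [two_mul_bform, a0, a1, a2, b0, b1, b2] at this
    exact this
  refine boundaryCond_iff.2 ⟨?_, eq_unitary_mulVec hV fun s => ?_,
    eq_unitary_mulVec hW fun s => ?_⟩
  · have h := key 0 0 1
    simp only [Matrix.mulVec_zero, star_zero, dotProduct_zero, sub_zero, zero_add, mul_one,
      map_one] at h
    have h2 : (2 * (-1) ^ k : ℂ) ≠ 0 := by simp
    have h3 := mul_left_cancel₀ h2 h
    rw [← h3]
    linear_combination (-der l k z l) * theta_mul_conj hθ
  · simpa using key s 0 0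
  · simpa using key 0 s 0

end BoundarySpace

/-! ### The adjoint relation and self-adjointness. -/

section Adjoint

theorem inner_eq_integral {l : ℝ} {f g : L2 l} {u v : ℝ → ℂ} (hf : f =ᵐ[vol l] u)
    (hg : g =ᵐ[vol l] v) :
    inner ℂ f g = ∫ x, v x * starRingEnd ℂ (u x) ∂(vol l) := by
  rw [L2.inner_def]
  refine integral_congr_ae ?_
  filter_upwards [hf, hg] with x h1 h2
  rw [h1, h2]
  rfl

theorem conj_neg_I_pow (k : ℕ) :
    starRingEnd ℂ ((-Complex.I) ^ (2 * k + 1)) = -(-Complex.I) ^ (2 * k + 1) := by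
  rw [map_pow, map_neg, Complex.conj_I, neg_neg, Odd.neg_pow ⟨k, rfl⟩, neg_neg]

/-- Green's formula in terms of classes of functions. -/
theorem inner_sub_inner {l : ℝ} (hl : 0 < l) {k : ℕ} {a b f g : L2 l} {y u : ℝ → ℂ}
    (hy : IsSobolevSucc l (2 * k) y) (hu : IsSobolevSucc l (2 * k) u)
    (ha : a =ᵐ[vol l] y)
    (hb : b =ᵐ[vol l] fun x => (-Complex.I) ^ (2 * k + 1) * der l (2 * k + 1) y x)
    (hf : f =ᵐ[vol l] u)
    (hg : g =ᵐ[vol l] fun x => (-Complex.I) ^ (2 * k + 1) * der l (2 * k + 1) u x) :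
    inner ℂ b f - inner ℂ a g =
      -(-Complex.I) ^ (2 * k + 1) * (bform l (2 * k) u y l - bform l (2 * k) u y 0) := by
  rw [← green hl hu hy, inner_eq_integral hb hf, inner_eq_integral ha hg]
  have h1 : ∀ x, u x * starRingEnd ℂ ((-Complex.I) ^ (2 * k + 1) * der l (2 * k + 1) y x) =
      -(-Complex.I) ^ (2 * k + 1) * (u x * starRingEnd ℂ (der l (2 * k + 1) y x)) := fun x => by
    rw [map_mul, conj_neg_I_pow]; ring
  have h2 : ∀ x, (-Complex.I) ^ (2 * k + 1) * der l (2 * k + 1) u x * starRingEnd ℂ (y x) =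
      (-Complex.I) ^ (2 * k + 1) * (der l (2 * k + 1) u x * starRingEnd ℂ (y x)) := fun x =>
    mul_assoc _ _ _
  simp only [h1, h2, integral_const_mul]
  rw [pow_mul (-1 : ℂ) 2 k]
  norm_num
  ring

theorem memLp_polyFun (l : ℝ) (q : Polynomial ℂ) : MemLp (polyFun q) 2 (vol l) :=
  memLp_of_continuousOn (contDiff_polyFun (n := 0) q).continuous.continuousOn

/-- The class of a polynomial in `L²(0, l)`. -/
noncomputable def polyL2 (l : ℝ) : Polynomial ℂ →ₗ[ℂ] L2 l where
  toFun q := (memLp_polyFun l q).toLp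
  map_add' p q := by
    rw [← MemLp.toLp_add]
    congr 1
    funext x
    simp [polyFun]
  map_smul' c q := by
    rw [RingHom.id_apply, ← MemLp.toLp_const_smul]
    congr 1
    funext x
    simp [polyFun]

theorem polyL2_ae (l : ℝ) (q : Polynomial ℂ) : polyL2 l q =ᵐ[vol l] polyFun q :=
  (memLp_polyFun l q).coeFn_toLp

/-- The classes of polynomials of degree at most `n`. -/
noncomputable def polySpace (l : ℝ) (n : ℕ) : Submodule ℂ (L2 l) :=
  (Polynomial.degreeLT ℂ (n + 1)).map (polyL2 l)

/-- Needed for `polySpace` to equal its double orthogonal complement. -/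
instance (l : ℝ) (n : ℕ) : FiniteDimensional ℂ (polySpace l n) :=
  have : FiniteDimensional ℂ (Polynomial.degreeLT ℂ (n + 1)) :=
    Module.Finite.equiv (Polynomial.degreeLTEquiv ℂ (n + 1)).symm
  inferInstanceAs (FiniteDimensional ℂ ((Polynomial.degreeLT ℂ (n + 1)).map (polyL2 l)))

theorem isSobolevSucc_polyFun {l : ℝ} (hl : 0 < l) (n : ℕ) (q : Polynomial ℂ) :
    IsSobolevSucc l n (polyFun q) :=
  isSobolevSucc_of_contDiff hl n (contDiff_polyFun q)

theorem der_polyFun_eq_zero {l : ℝ} (hl : 0 < l) {n : ℕ} {q : Polynomial ℂ}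
    (hq : q ∈ Polynomial.degreeLT ℂ (n + 1)) {x : ℝ} (hx : x ∈ Icc 0 l) :
    der l (n + 1) (polyFun q) x = 0 := by
  have : Polynomial.derivative^[n + 1] q = 0 := by
    by_cases h : q = 0
    · simp [h]
    · exact Polynomial.iterate_derivative_eq_zero
        ((Polynomial.natDegree_lt_iff_degree_lt h).2 (Polynomial.mem_degreeLT.1 hq))
  rw [der_polyFun hl q (n + 1) hx, this]
  simp [polyFun]

/-- A function orthogonal to the polynomials of degree at most `n` is the derivative of order
`n + 1` of a function whose derivatives of lower order vanish at both end points. -/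
theorem exists_of_mem_orthogonal_polySpace {l : ℝ} (hl : 0 < l) {n : ℕ} {w : L2 l}
    (hw : w ∈ (polySpace l n)ᗮ) :
    ∃ y, IsSobolevSucc l n y ∧ (∀ j ≤ n, der l j y 0 = 0 ∧ der l j y l = 0) ∧
      der l (n + 1) y =ᵐ[vol l] w := by
  obtain ⟨y, hy, h0, hd⟩ := exists_isSobolevSucc_der_eq hl n (Lp.memLp w)
  refine ⟨y, hy, fun j hj => ⟨h0 j hj, ?_⟩, hd⟩
  -- In Green's formula against this `q` both integrals and the form at `0` vanish, and the form at
  -- `l` reduces to `± y^(j)(l)`.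
  obtain ⟨q, hq, hqd⟩ := exists_polynomial_derivative_eq n l (fun i => if i = n - j then 1 else 0)
  have hz := isSobolevSucc_polyFun hl n q
  have h1 : ∫ x, der l (n + 1) y x * starRingEnd ℂ (polyFun q x) ∂(vol l) = 0 := by
    rw [← inner_eq_integral (polyL2_ae l q) hd.symm]
    exact (Submodule.mem_orthogonal _ _).1 hw _ ⟨q, hq, rfl⟩
  have h2 : ∫ x, y x * starRingEnd ℂ (der l (n + 1) (polyFun q) x) ∂(vol l) = 0 := by
    refine integral_eq_zero_of_ae ?_
    filter_upwards [ae_restrict_mem measurableSet_Ioo] with x hx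
    simp [der_polyFun_eq_zero hl hq (Ioo_subset_Icc_self hx)]
  have h3 : bform l n y (polyFun q) 0 = 0 := Finset.sum_eq_zero fun i _ => by
    rw [h0 _ (by omega)]; simp
  have h4 : bform l n y (polyFun q) l = (-1) ^ (n - j) * der l j y l := by
    rw [bform, Finset.sum_eq_single (n - j)]
    · rw [der_polyFun hl q _ ⟨hl.le, le_rfl⟩, polyFun, hqd _ (by omega), if_pos rfl,
        show n - (n - j) = j by omega]
      simp
    · intro i hi hne
      have := Finset.mem_range.1 hi
      rw [der_polyFun hl q _ ⟨hl.le, le_rfl⟩, polyFun, hqd _ (by omega), if_neg hne]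
      simp
    · intro h
      exact absurd (Finset.mem_range.2 (by omega)) h
  have key := green hl hy hz
  rw [h1, h2, h3, h4] at key
  simpa using key

theorem boundaryCond_of_der_eq_zero {l : ℝ} {k : ℕ} {θ : ℂ} {V W : Matrix (Fin k) (Fin k) ℂ}
    {y : ℝ → ℂ} (h : ∀ j ≤ 2 * k, der l j y 0 = 0 ∧ der l j y l = 0) :
    BoundaryCond l k θ V W y := by
  have e0 : Y₀ l k y 0 = 0 := funext fun i => (h _ (by omega)).1
  have el : Y₀ l k y l = 0 := funext fun i => (h _ (by omega)).2
  have f0 : Y₁ l k y 0 = 0 := funext fun i => (h _ (by omega)).1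
  have fl : Y₁ l k y l = 0 := funext fun i => (h _ (by omega)).2
  constructor
  · rw [(h k (by omega)).1, (h k (by omega)).2, mul_zero]
  · simp [e0, el, f0]
  · simp [e0, f0, fl]

theorem opGraph_adjoint {l : ℝ} (hl : 0 < l) {k : ℕ} {θ : ℂ} (hθ : ‖θ‖ = 1)
    {V W : Matrix (Fin k) (Fin k) ℂ} (hV : V ∈ Matrix.unitaryGroup (Fin k) ℂ)
    (hW : W ∈ Matrix.unitaryGroup (Fin k) ℂ) :
    (opGraph l hl k θ V W).adjoint = opGraph l hl k θ V W := by
  set c : ℂ := (-Complex.I) ^ (2 * k + 1) with hc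
  have hc0 : c ≠ 0 := pow_ne_zero _ (neg_ne_zero.2 Complex.I_ne_zero)
  ext ⟨f, g⟩
  rw [Submodule.mem_adjoint_iff]
  constructor
  · intro h
    -- The values of `u` at `0` are irrelevant: a polynomial corrects `u` below.
    obtain ⟨u, hu, -, hud⟩ := exists_isSobolevSucc_der_eq hl (2 * k)
      ((Lp.memLp g).const_mul c⁻¹)
    have hgu : g =ᵐ[vol l] fun x => c * der l (2 * k + 1) u x := by
      filter_upwards [hud] with x hx
      rw [hx]
      field_simp
    obtain ⟨U, hUu⟩ : ∃ U : L2 l, U =ᵐ[vol l] u := ⟨_, hu.memLp_self.coeFn_toLp⟩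
    have hmem : f - U ∈ polySpace l (2 * k) := by
      rw [← Submodule.orthogonal_orthogonal (polySpace l (2 * k)), Submodule.mem_orthogonal]
      intro w hw
      obtain ⟨y, hy, h0, hyd⟩ := exists_of_mem_orthogonal_polySpace hl hw
      obtain ⟨Y, hYy⟩ : ∃ Y : L2 l, Y =ᵐ[vol l] y := ⟨_, hy.memLp_self.coeFn_toLp⟩
      have hcw : (c • w : L2 l) =ᵐ[vol l] fun x => c * der l (2 * k + 1) y x := by
        filter_upwards [Lp.coeFn_smul c w, hyd] with x h1 h2
        rw [h1, h2]
        rfl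
      have e1 := h Y (c • w) (show (Y, c • w) ∈ opGraph l hl k θ V W from
        ⟨y, hy, boundaryCond_of_der_eq_zero h0, hYy, hcw⟩)
      have e2 := inner_sub_inner hl hy hu hYy hcw hUu hgu
      have b0 : bform l (2 * k) u y 0 = 0 := Finset.sum_eq_zero fun i hi => by
        rw [(h0 i (by have := Finset.mem_range.1 hi; omega)).1]; simp
      have bl : bform l (2 * k) u y l = 0 := Finset.sum_eq_zero fun i hi => by
        rw [(h0 i (by have := Finset.mem_range.1 hi; omega)).2]; simp
      rw [b0, bl, sub_zero, mul_zero] at e2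
      simp only at e1
      have e3 : inner ℂ (c • w) (f - U) = 0 := by
        rw [inner_sub_right]
        linear_combination e1 - e2
      rw [inner_smul_left] at e3
      exact (mul_eq_zero.1 e3).resolve_left ((map_ne_zero _).2 hc0)
    obtain ⟨q, hq, hqf⟩ := hmem
    have hF : IsSobolevSucc l (2 * k) (u + polyFun q) :=
      hu.add hl (isSobolevSucc_polyFun hl _ q)
    have hf : f =ᵐ[vol l] u + polyFun q := by
      have e : f = U + polyL2 l q := by rw [hqf]; abel
      rw [e]
      exact (Lp.coeFn_add _ _).trans (hUu.add (polyL2_ae l q))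
    have hg : g =ᵐ[vol l] fun x => c * der l (2 * k + 1) (u + polyFun q) x := by
      filter_upwards [hgu, der_succ_add_ae hl hu (isSobolevSucc_polyFun hl _ q),
        ae_restrict_mem measurableSet_Ioo] with x h1 h2 hx
      rw [h1, h2, Pi.add_apply, der_polyFun_eq_zero hl hq (Ioo_subset_Icc_self hx), add_zero]
    -- With regularity known, testing against the whole domain yields the boundary conditions.
    refine ⟨u + polyFun q, hF, boundaryCond_of_forall_bform hl hθ hV hW fun y hy bc => ?_, hf, hg⟩
    obtain ⟨Y, hYy⟩ : ∃ Y : L2 l, Y =ᵐ[vol l] y := ⟨_, hy.memLp_self.coeFn_toLp⟩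
    obtain ⟨Y', hYd⟩ : ∃ Y' : L2 l, Y' =ᵐ[vol l] fun x => c * der l (2 * k + 1) y x :=
      ⟨_, (hy.memLp.const_mul c).coeFn_toLp⟩
    have e1 := h Y Y' (show (Y, Y') ∈ opGraph l hl k θ V W from ⟨y, hy, bc, hYy, hYd⟩)
    simp only at e1
    rw [inner_sub_inner hl hy hF hYy hYd hf hg] at e1
    exact sub_eq_zero.1 ((mul_eq_zero.1 e1).resolve_left (neg_ne_zero.2 hc0))
  · rintro ⟨u, hu, bu, hf, hg⟩ a b ⟨y, hy, bc, ha, hb⟩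
    rw [inner_sub_inner hl hy hu ha hb hf hg, bu.bform_eq hθ hV hW bc, sub_self, mul_zero]

/-- The adjoint of a relation makes sense without density. If `g` is orthogonal to the domain, then
`(0, g)` lies in the adjoint relation, which is the graph itself, so `g = 0`. -/
theorem dense_op_domain {l : ℝ} (hl : 0 < l) {k : ℕ} {θ : ℂ} (hθ : ‖θ‖ = 1)
    {V W : Matrix (Fin k) (Fin k) ℂ} (hV : V ∈ Matrix.unitaryGroup (Fin k) ℂ)
    (hW : W ∈ Matrix.unitaryGroup (Fin k) ℂ) :
    Dense ((op l hl k θ V W).domain : Set (L2 l)) := by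
  rw [Submodule.dense_iff_topologicalClosure_eq_top, Submodule.topologicalClosure_eq_top_iff,
    Submodule.eq_bot_iff]
  intro g hg
  have h : ((0 : L2 l), g) ∈ opGraph l hl k θ V W := by
    rw [← opGraph_adjoint hl hθ hV hW, Submodule.mem_adjoint_iff]
    intro a b hab
    rw [← op_graph, LinearPMap.mem_graph_iff] at hab
    obtain ⟨a', rfl, -⟩ := hab
    rw [(Submodule.mem_orthogonal _ _).1 hg _ a'.2]
    simp
  rw [← op_graph] at h
  exact LinearPMap.graph_fst_eq_zero_snd _ h rfl

end Adjoint

end OddBVP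

theorem mainTheorem12 (k : ℕ) (l : ℝ) (hl : 0 < l) (θ : ℂ) (hθ : ‖θ‖ = 1)
    (V W : Matrix (Fin k) (Fin k) ℂ)
    (hV : V ∈ Matrix.unitaryGroup (Fin k) ℂ) (hW : W ∈ Matrix.unitaryGroup (Fin k) ℂ) :
    Dense ((OddBVP.op l hl k θ V W).domain : Set (OddBVP.L2 l)) ∧
      IsSelfAdjoint (OddBVP.op l hl k θ V W) := by
  have hd := OddBVP.dense_op_domain hl hθ hV hW
  refine ⟨hd, LinearPMap.isSelfAdjoint_def.2 (LinearPMap.eq_of_eq_graph ?_)⟩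
  -- Density identifies the graph of the adjoint operator with the adjoint relation.
  rw [LinearPMap.adjoint_graph_eq_graph_adjoint hd, OddBVP.op_graph,
    OddBVP.opGraph_adjoint hl hθ hV hW]
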